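/- **Setting.** Let $X, L$ be independent real random variables on a probability space, with $X>0$ a.s., $X$, $X^{-1}$, $L$ integrable, $\mathbb E[X]=1$, $\mathbb E[L]=0$ and $\operatorname{Var}[\ln X]>0$. Suppose $L$ has a bounded, strictly positive density $f_L$. Let $\alpha\in(0,1)$, let $q:=F_L^{-1}(1-\alpha)$ be the $(1-\alpha)$-quantile of $L$, and assume that $f_L$ is three times continuously differentiable in a neighbourhood of $q$. Put $$Y:=\frac{\ln X-\mathbb E[\ln X]}{\sqrt{\operatorname{Var}[\ln X]}},\qquad \mu_i:=\mathbb E[Y^i],\qquad X_\sigma:=\frac{e^{\sigma Y}}{\mathbb E[e^{\sigma Y}]},\qquad S_\sigma(\phi):=\phi\,(X_\sigma-1)-X_\sigma L,$$ where $\mathbb E[e^{\sigma Y}]<\infty$ at least for $0\le\sigma\le\sqrt{\operatorname{Var}[\ln X]}$; for such $\sigma>0$, $\ln X_\sigma$ has standard deviation $\sigma$, skew $\mu_3$ and kurtosis $\mu_4$, and $X_\sigma=X$ a.s. for $\sigma=\sqrt{\operatorname{Var}[\ln X]}$. Let $\mathrm{VaR}_\alpha[Z]:=\inf\{m\in\mathbb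 R:\mathbb P(Z+m<0)\le\alpha\}$, and let $\mathrm{id}$ be the identity function on $\mathbb R$. **(a)** For every $\phi\in\mathbb R$, as $\sigma\downarrow0$, $$\begin{aligned}\mathrm{VaR}_\alpha[S_\sigma(\phi)]=q-\frac1{f_L(q)}\Big\{&\frac{\sigma^2}{2}\big[(\phi-\mathrm{id})^2f_L\big]'(q)+\frac{\sigma^3\mu_3}{6}\big[(\phi-\mathrm{id})^3f_L'\big]'(q)\\&+\frac{\sigma^4}{24}\Big[\mu_4\big[(\phi-\mathrm{id})^4f_L'\big]'-3\,\frac{\big(\big((\phi-\mathrm{id})^2f_L\big)'\big)^2}{f_L}+(2\mu_4-6)(\phi-\mathrm{id})^3f_L'+(\mu_4+3)(\phi-\mathrm{id})^2f_L\Big]'(q)\Big\}+o(\sigma^4).\end{aligned}$$ **(b)** For $\sigma>0$ let $$V_3(\phi):=q-\frac1{f_L(q)}\Big\{\frac{\sigma^2}{2}\big[(\phi-\mathrm{id})^2f_L\big]'(q)+\frac{\sigma^3\mu_3}{6}\big[(\phi-\mathrm{id})^3f_L'\big]'(q)\Big\},\qquad \phi\in\mathbb R,$$ be the expansion in (a)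 up to third order. * Suppose $\mu_3 f_L''(q)\ne0$. Put $\delta:=\frac1{\sigma\mu_3}$ and $D:=(1-\delta)^2f_L'(q)^2+2\delta f_L''(q)f_L(q)$. If $D>0$, then $V_3$ has exactly one local minimiser, namely $$\phi^*=q+f_L''(q)^{-1}\Big((1-\delta)f_L'(q)-\operatorname{sgn}(\mu_3)\sqrt D\Big).$$ If $D\le0$, then $V_3$ has no local minimiser. If $f_L'(q)\neq0$, then $D>0$ for all sufficiently small $\sigma>0$. * Suppose $\mu_3 f_L''(q)=0$. Then $V_3$ attains a global minimum on $\mathbb R$ if and only if $(1-\sigma\mu_3)f_L'(q)<0$, and in that case the unique minimiser is $$\phi^*=q+\frac{f_L(q)}{(1-\sigma\mu_3)f_L'(q)}.$$ In particular, if $\mu_3=0$, a minimum exists if and only if $f_L'(q)<0$, and then the unique minimiser is $\phi^*=q+f_L(q)/f_L'(q)$. -/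

import Mathlib

open MeasureTheory ProbabilityTheory Filter Topology Asymptotics

namespace SurplusRisk

variable {Ω : Type*} [MeasurableSpace Ω]

/-- Value-at-risk of the position `Z` at level `α`: the least capital `m` for which the
probability that `Z + m` is negative does not exceed `α`. -/
noncomputable def VaR (P : Measure Ω) (α : ℝ) (Z : Ω → ℝ) : ℝ :=
  sInf {m : ℝ | P.real {ω | Z ω + m < 0} ≤ α}

/-- The quantile function `p ↦ F⁻¹(p)` of a probability law on the line. -/
noncomputable def quantile (μ : Measure ℝ) (p : ℝ) : ℝ :=
  sInf {x : ℝ | p ≤ cdf μ x}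

/-- The surplus `S(φ) = φ (X - 1) - X L` for one asset `X` of initial price one. -/
def surplus (X L : Ω → ℝ) (φ : ℝ) : Ω → ℝ :=
  fun ω => φ * (X ω - 1) - X ω * L ω

/-- The centred and normalised logarithm `Y = (ln X - E[ln X]) / √Var[ln X]`. -/
noncomputable def normLog (P : Measure Ω) (X : Ω → ℝ) : Ω → ℝ :=
  fun ω => (Real.log (X ω) - ∫ ω', Real.log (X ω') ∂P) /
    Real.sqrt (variance (fun ω' => Real.log (X ω')) P)

/-- The `i`-th centred normalised moment `μ_i = E[Y^i]` of `ln X`. -/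
noncomputable def logMoment (P : Measure Ω) (X : Ω → ℝ) (i : ℕ) : ℝ :=
  ∫ ω, normLog P X ω ^ i ∂P

/-- The version `X_σ = exp(σ Y) / E[exp(σ Y)]` of the asset with log-normal volatility `σ`. -/
noncomputable def assetVol (P : Measure Ω) (X : Ω → ℝ) (σ : ℝ) : Ω → ℝ :=
  fun ω => Real.exp (σ * normLog P X ω) / mgf (normLog P X) P σ

/-- The expansion of the value-at-risk of `S(φ)` up to third order in `σ`,
for a claim density `f` and a log-asset skew `μ₃`. -/
noncomputable def expansion3 (f : ℝ → ℝ) (q μ₃ σ φ : ℝ) : ℝ :=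
  q - 1 / f q *
    (σ ^ 2 / 2 * deriv (fun y => (φ - y) ^ 2 * f y) q
      + σ ^ 3 * μ₃ / 6 * deriv (fun y => (φ - y) ^ 3 * deriv f y) q)

/-- The expansion of the value-at-risk of `S(φ)` up to fourth order in `σ`,
for a claim density `f`, log-asset skew `μ₃` and log-asset kurtosis `μ₄`. -/
noncomputable def expansion4 (f : ℝ → ℝ) (q μ₃ μ₄ σ φ : ℝ) : ℝ :=
  q - 1 / f q *
    (σ ^ 2 / 2 * deriv (fun y => (φ - y) ^ 2 * f y) q
      + σ ^ 3 * μ₃ / 6 * deriv (fun y => (φ - y) ^ 3 * deriv f y) q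
      + σ ^ 4 / 24 * deriv (fun y =>
          μ₄ * deriv (fun t => (φ - t) ^ 4 * deriv f t) y
          - 3 * (deriv (fun t => (φ - t) ^ 2 * f t) y ^ 2 / f y)
          + (2 * μ₄ - 6) * ((φ - y) ^ 3 * deriv f y)
          + (μ₄ + 3) * ((φ - y) ^ 2 * f y)) q)

/-- The quantity under the square root in the minimiser, where `a = f(q)`, `a₁ = f'(q)`,
`a₂ = f''(q)`. -/
def discr (a a₁ a₂ δ : ℝ) : ℝ :=
  (1 - δ) ^ 2 * a₁ ^ 2 + 2 * δ * a₂ * a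

end SurplusRisk

/-! Since `X_σ > 0`, dividing the ruin event `S_σ(φ) + m < 0` by `X_σ` turns it into `L > φ + (m -
φ) / X_σ`. By independence its probability is `1 - E[F(φ + (m - φ) M(σ) e^{-σY})]`, where `F` is the
cdf of `L` and `M` the mgf of `Y`. Along the curve `m(σ) = expansion4 + ε σ⁴` the argument of `F` is
`q + W` with `W` of size `σ`, and this expectation equals `1 - α + f(q) ε σ⁴ + o(σ⁴)`
(`hasExp_integral_cdf`): the coefficients of `expansion4` are exactly those that cancel the orders
2, 3 and 4. Ruin probability decreases in `m`, so the signs `±ε` trap the value-at-risk between the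
two curves for small `σ` (`VaR_mem_Icc`). No regularity of the value-at-risk in `σ` is needed.

The expectation is expanded in `HasExp.integral_comp`. `F` has a fourth-order Taylor polynomial at
`q` because `f` is `C³` there, and boundedness of `F` makes the Taylor error at most `ε w⁴ + C w⁶`
for all `w`. The moments of `W` are combinations of values of `M` near zero, where `M` is analytic
because `X` and `X⁻¹` are integrable.

For (b), `expansion3` is a polynomial in `φ - q` of degree at most three with linear term `σ² (φ -
q)`; its minimisers follow from a cubic and a quadratic criterion. -/

namespace SurplusRisk

/-! ### Calculus of fourth-order expansions at the origin -/

/-- `g` has the fourth-order expansion `c₀ + c₁ s + ⋯ + c₄ s⁴` at the origin. -/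
def HasExp (g : ℝ → ℝ) (c₀ c₁ c₂ c₃ c₄ : ℝ) : Prop :=
  (fun s => g s - (c₀ + c₁ * s + c₂ * s ^ 2 + c₃ * s ^ 3 + c₄ * s ^ 4)) =o[𝓝 0] fun s => s ^ 4

namespace HasExp

variable {g h : ℝ → ℝ} {c₀ c₁ c₂ c₃ c₄ d₀ d₁ d₂ d₃ d₄ : ℝ}

theorem congr_coeff (H : HasExp g c₀ c₁ c₂ c₃ c₄) (h₀ : c₀ = d₀) (h₁ : c₁ = d₁) (h₂ : c₂ = d₂)
    (h₃ : c₃ = d₃) (h₄ : c₄ = d₄) : HasExp g d₀ d₁ d₂ d₃ d₄ := by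
  subst h₀ h₁ h₂ h₃ h₄; exact H

theorem congr (H : HasExp g c₀ c₁ c₂ c₃ c₄) (hgh : ∀ᶠ s in 𝓝 0, g s = h s) :
    HasExp h c₀ c₁ c₂ c₃ c₄ := by
  refine IsLittleO.congr' H ?_ EventuallyEq.rfl
  filter_upwards [hgh] with s hs
  rw [hs]

theorem of_sub_isLittleO (H : HasExp g c₀ c₁ c₂ c₃ c₄)
    (hgh : (fun s => h s - g s) =o[𝓝 0] fun s => s ^ 4) : HasExp h c₀ c₁ c₂ c₃ c₄ :=
  (hgh.add H).congr_left fun s => by ring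

theorem poly (c₀ c₁ c₂ c₃ c₄ : ℝ) :
    HasExp (fun s => c₀ + c₁ * s + c₂ * s ^ 2 + c₃ * s ^ 3 + c₄ * s ^ 4) c₀ c₁ c₂ c₃ c₄ := by
  simp [HasExp]

theorem const (c : ℝ) : HasExp (fun _ => c) c 0 0 0 0 := by
  simp [HasExp]

theorem add (H : HasExp g c₀ c₁ c₂ c₃ c₄) (K : HasExp h d₀ d₁ d₂ d₃ d₄) :
    HasExp (fun s => g s + h s) (c₀ + d₀) (c₁ + d₁) (c₂ + d₂) (c₃ + d₃) (c₄ + d₄) := by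
  refine (IsLittleO.add H K).congr_left fun s => ?_
  ring

theorem const_mul (c : ℝ) (H : HasExp g c₀ c₁ c₂ c₃ c₄) :
    HasExp (fun s => c * g s) (c * c₀) (c * c₁) (c * c₂) (c * c₃) (c * c₄) := by
  refine (IsLittleO.const_mul_left H c).congr_left fun s => ?_
  ring

theorem comp_mul (c : ℝ) (H : HasExp g c₀ c₁ c₂ c₃ c₄) :
    HasExp (fun s => g (c * s)) c₀ (c₁ * c) (c₂ * c ^ 2) (c₃ * c ^ 3) (c₄ * c ^ 4) := by
  have ht : Tendsto (fun s : ℝ => c * s) (𝓝 0) (𝓝 0) := by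
    have : Continuous fun s : ℝ => c * s := by fun_prop
    simpa using this.tendsto 0
  have h1 := IsLittleO.comp_tendsto H ht
  have h2 : ((fun s : ℝ => s ^ 4) ∘ fun s => c * s) =O[𝓝 0] fun s => s ^ 4 :=
    (isBigO_const_mul_self (c ^ 4) (fun s : ℝ => s ^ 4) (𝓝 0)).congr_left fun s => by
      simp [mul_pow]
  refine (h1.trans_isBigO h2).congr_left fun s => ?_
  simp only [Function.comp]
  ring

theorem isBigO_one (H : HasExp g c₀ c₁ c₂ c₃ c₄) : g =O[𝓝 0] fun _ => (1 : ℝ) := by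
  have h4 : (fun s : ℝ => s ^ 4) =O[𝓝 0] fun _ => (1 : ℝ) :=
    (by fun_prop : Continuous fun s : ℝ => s ^ 4).continuousAt.isBigO_one ℝ
  have hp : (fun s : ℝ => c₀ + c₁ * s + c₂ * s ^ 2 + c₃ * s ^ 3 + c₄ * s ^ 4) =O[𝓝 0]
      fun _ => (1 : ℝ) :=
    (by fun_prop : Continuous fun s : ℝ =>
      c₀ + c₁ * s + c₂ * s ^ 2 + c₃ * s ^ 3 + c₄ * s ^ 4).continuousAt.isBigO_one ℝ
  exact ((H.isBigO.trans h4).add hp).congr_left fun s => by ring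

theorem mul (H : HasExp g c₀ c₁ c₂ c₃ c₄) (K : HasExp h d₀ d₁ d₂ d₃ d₄) :
    HasExp (fun s => g s * h s) (c₀ * d₀) (c₀ * d₁ + c₁ * d₀) (c₀ * d₂ + c₁ * d₁ + c₂ * d₀)
      (c₀ * d₃ + c₁ * d₂ + c₂ * d₁ + c₃ * d₀)
      (c₀ * d₄ + c₁ * d₃ + c₂ * d₂ + c₃ * d₁ + c₄ * d₀) := by
  have h1 := IsLittleO.mul_isBigO H K.isBigO_one
  have h2 := (poly c₀ c₁ c₂ c₃ c₄).isBigO_one.mul_isLittleO K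
  -- The product of the two polynomials leaves terms of degree 5 to 8; this is their quotient by `s
  -- ^ 5`.
  have hr : (fun s : ℝ => (c₁ * d₄ + c₂ * d₃ + c₃ * d₂ + c₄ * d₁) + (c₂ * d₄ + c₃ * d₃ + c₄ * d₂) * s
      + (c₃ * d₄ + c₄ * d₃) * s ^ 2 + (c₄ * d₄) * s ^ 3) =O[𝓝 0] fun _ => (1 : ℝ) :=
    (by fun_prop : Continuous fun s : ℝ => (c₁ * d₄ + c₂ * d₃ + c₃ * d₂ + c₄ * d₁)
      + (c₂ * d₄ + c₃ * d₃ + c₄ * d₂) * s + (c₃ * d₄ + c₄ * d₃) * s ^ 2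
      + (c₄ * d₄) * s ^ 3).continuousAt.isBigO_one ℝ
  have h5 : (fun s : ℝ => s ^ 5) =o[𝓝 0] fun s => s ^ 4 := isLittleO_pow_pow (by norm_num)
  have h3 := hr.mul_isLittleO h5
  simp only [mul_one, one_mul] at h1 h2 h3
  refine ((h1.add h2).add h3).congr_left fun s => ?_
  ring

/-- Only curves without linear term occur below: both `m(σ)` and the mgf of the centred `Y` lack
one. -/
theorem pow_two_to_six {x : ℝ} (H : HasExp g x 0 c₂ c₃ c₄) :
    HasExp (fun s => g s ^ 2) (x ^ 2) 0 (2 * x * c₂) (2 * x * c₃) (2 * x * c₄ + c₂ ^ 2) ∧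
    HasExp (fun s => g s ^ 3) (x ^ 3) 0 (3 * x ^ 2 * c₂) (3 * x ^ 2 * c₃)
      (3 * x ^ 2 * c₄ + 3 * x * c₂ ^ 2) ∧
    HasExp (fun s => g s ^ 4) (x ^ 4) 0 (4 * x ^ 3 * c₂) (4 * x ^ 3 * c₃)
      (4 * x ^ 3 * c₄ + 6 * x ^ 2 * c₂ ^ 2) ∧
    HasExp (fun s => g s ^ 5) (x ^ 5) 0 (5 * x ^ 4 * c₂) (5 * x ^ 4 * c₃)
      (5 * x ^ 4 * c₄ + 10 * x ^ 3 * c₂ ^ 2) ∧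
    HasExp (fun s => g s ^ 6) (x ^ 6) 0 (6 * x ^ 5 * c₂) (6 * x ^ 5 * c₃)
      (6 * x ^ 5 * c₄ + 15 * x ^ 4 * c₂ ^ 2) := by
  have succ : ∀ {n : ℕ} {d₀ d₂ d₃ d₄ e₀ e₂ e₃ e₄ : ℝ}, HasExp (fun s => g s ^ n) d₀ 0 d₂ d₃ d₄ →
      d₀ * x = e₀ → d₀ * c₂ + d₂ * x = e₂ → d₀ * c₃ + d₃ * x = e₃ →
      d₀ * c₄ + d₂ * c₂ + d₄ * x = e₄ → HasExp (fun s => g s ^ (n + 1)) e₀ 0 e₂ e₃ e₄ := by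
    intro n d₀ d₂ d₃ d₄ e₀ e₂ e₃ e₄ K h₀ h₂ h₃ h₄
    refine ((K.mul H).congr (Eventually.of_forall fun s => (pow_succ (g s) n).symm)).congr_coeff
      h₀ (by ring) (by rw [← h₂]; ring) (by rw [← h₃]; ring) (by rw [← h₄]; ring)
  have k1 : HasExp (fun s => g s ^ 1) x 0 c₂ c₃ c₄ := by simpa only [pow_one] using H
  have k2 : HasExp (fun s => g s ^ 2) (x ^ 2) 0 (2 * x * c₂) (2 * x * c₃)
      (2 * x * c₄ + c₂ ^ 2) := succ k1 (by ring) (by ring) (by ring) (by ring)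
  have k3 : HasExp (fun s => g s ^ 3) (x ^ 3) 0 (3 * x ^ 2 * c₂) (3 * x ^ 2 * c₃)
      (3 * x ^ 2 * c₄ + 3 * x * c₂ ^ 2) := succ k2 (by ring) (by ring) (by ring) (by ring)
  have k4 : HasExp (fun s => g s ^ 4) (x ^ 4) 0 (4 * x ^ 3 * c₂) (4 * x ^ 3 * c₃)
      (4 * x ^ 3 * c₄ + 6 * x ^ 2 * c₂ ^ 2) := succ k3 (by ring) (by ring) (by ring) (by ring)
  have k5 : HasExp (fun s => g s ^ 5) (x ^ 5) 0 (5 * x ^ 4 * c₂) (5 * x ^ 4 * c₃)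
      (5 * x ^ 4 * c₄ + 10 * x ^ 3 * c₂ ^ 2) := succ k4 (by ring) (by ring) (by ring) (by ring)
  exact ⟨k2, k3, k4, k5, succ k5 (by ring) (by ring) (by ring) (by ring)⟩

theorem isBigO_pow_four (H : HasExp g 0 0 0 0 c₄) : g =O[𝓝 0] fun s => s ^ 4 := by
  refine (H.isBigO.add (isBigO_const_mul_self c₄ (fun s : ℝ => s ^ 4) (𝓝 0))).congr_left fun s => ?_
  ring

theorem isLittleO_pow_four (H : HasExp g 0 0 0 0 0) : g =o[𝓝 0] fun s => s ^ 4 :=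
  IsLittleO.congr_left H fun s => by ring

end HasExp

/-- Fourth-order Taylor expansion with Peano remainder. -/
theorem ContDiffAt.hasExp {g : ℝ → ℝ} {q : ℝ} (hg : ContDiffAt ℝ 4 g q) :
    HasExp (fun s => g (q + s)) (g q) (deriv g q) (deriv (deriv g) q / 2)
      (deriv (deriv (deriv g)) q / 6) (deriv (deriv (deriv (deriv g))) q / 24) := by
  obtain ⟨r, hr, hball⟩ := Metric.eventually_nhds_iff_ball.1 (hg.eventually (by simp))
  have hon : ContDiffOn ℝ (4 : ℕ) g (Metric.ball q r) := fun y hy =>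
    (hball y hy).contDiffWithinAt
  have hq : q ∈ Metric.ball q r := Metric.mem_ball_self hr
  have h := taylor_isLittleO (convex_ball q r) hq hon
  rw [Metric.isOpen_ball.nhdsWithin_eq hq] at h
  have ht : Tendsto (fun s : ℝ => q + s) (𝓝 0) (𝓝 q) := by
    have : Continuous fun s : ℝ => q + s := by fun_prop
    simpa using this.tendsto 0
  have h2 := h.comp_tendsto ht
  have hder : ∀ n, iteratedDerivWithin n g (Metric.ball q r) q = iteratedDeriv n g q := fun n =>
    iteratedDerivWithin_of_isOpen Metric.isOpen_ball hq
  refine (h2.congr_left fun s => ?_).congr_right fun s => ?_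
  · simp only [Function.comp, taylor_within_apply, hder, Finset.sum_range_succ, Finset.sum_range_zero,
      iteratedDeriv_succ, iteratedDeriv_zero, add_sub_cancel_left, smul_eq_mul]
    norm_num [Nat.factorial]
    ring
  · simp [Function.comp]

theorem hasExp_mgf {Ω : Type*} [MeasurableSpace Ω] {P : Measure Ω} [IsProbabilityMeasure P]
    {Y : Ω → ℝ} (h0 : 0 ∈ interior (integrableExpSet Y P)) (hY1 : ∫ ω, Y ω ∂P = 0)
    (hY2 : ∫ ω, Y ω ^ 2 ∂P = 1) :
    HasExp (mgf Y P) 1 0 (1 / 2) ((∫ ω, Y ω ^ 3 ∂P) / 6) ((∫ ω, Y ω ^ 4 ∂P) / 24) := by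
  have h := ContDiffAt.hasExp (analyticAt_mgf h0).contDiffAt
  have key : ∀ n, iteratedDeriv n (mgf Y P) 0 = ∫ ω, Y ω ^ n ∂P := fun n => by
    simpa using iteratedDeriv_mgf_zero h0 n
  have k1 := key 1
  have k2 := key 2
  have k3 := key 3
  have k4 := key 4
  simp only [iteratedDeriv_succ, iteratedDeriv_zero, pow_one] at k1 k2 k3 k4
  rw [k1, k2, k3, k4, hY1, hY2] at h
  simpa using h

/-! ### Explicit polynomial form of the expansions -/

section Expansion

variable {f : ℝ → ℝ} {q : ℝ}

theorem hasDerivAt_sub_pow (φ y : ℝ) (n : ℕ) :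
    HasDerivAt (fun t : ℝ => (φ - t) ^ (n + 1)) (-((n + 1 : ℕ) * (φ - y) ^ n)) y := by
  have := ((hasDerivAt_id y).const_sub φ).pow (n + 1)
  convert! this using 1
  simp

theorem deriv_sub_pow_mul {g : ℝ → ℝ} (φ : ℝ) {y : ℝ} (n : ℕ) (hg : DifferentiableAt ℝ g y) :
    deriv (fun t => (φ - t) ^ (n + 1) * g t) y
      = -((n + 1 : ℕ) * (φ - y) ^ n) * g y + (φ - y) ^ (n + 1) * deriv g y :=
  ((hasDerivAt_sub_pow φ y n).mul hg.hasDerivAt).deriv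

theorem contDiffAt_deriv {g : ℝ → ℝ} {q : ℝ} {n : ℕ} (hg : ContDiffAt ℝ (n + 1 : ℕ) g q) :
    ContDiffAt ℝ n (deriv g) q := by
  exact (hg.fderiv_right (m := n) (by norm_cast)).clm_apply contDiffAt_const

theorem expansion3_eq (hf : ContDiffAt ℝ 3 f q) (μ₃ σ φ : ℝ) :
    expansion3 f q μ₃ σ φ = q - 1 / f q *
      (σ ^ 2 / 2 * (-2 * (φ - q) * f q + (φ - q) ^ 2 * deriv f q)
        + σ ^ 3 * μ₃ / 6 * (-3 * (φ - q) ^ 2 * deriv f q + (φ - q) ^ 3 * deriv (deriv f) q)) := by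
  have h1 : DifferentiableAt ℝ (deriv f) q :=
    (contDiffAt_deriv (n := 2) hf).differentiableAt (by norm_num)
  rw [expansion3, deriv_sub_pow_mul φ 1 (hf.differentiableAt (by norm_num)),
    deriv_sub_pow_mul φ 2 h1]
  push_cast
  ring

theorem expansion4_eq (hf : ContDiffAt ℝ 3 f q) (h0 : f q ≠ 0) (μ₃ μ₄ σ φ : ℝ) :
    expansion4 f q μ₃ μ₄ σ φ = q - 1 / f q *
      (σ ^ 2 / 2 * (-2 * (φ - q) * f q + (φ - q) ^ 2 * deriv f q)
        + σ ^ 3 * μ₃ / 6 * (-3 * (φ - q) ^ 2 * deriv f q + (φ - q) ^ 3 * deriv (deriv f) q)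
        + σ ^ 4 / 24 * (μ₄ * (12 * (φ - q) ^ 2 * deriv f q - 8 * (φ - q) ^ 3 * deriv (deriv f) q
              + (φ - q) ^ 4 * deriv (deriv (deriv f)) q)
            - 3 * (2 * (-2 * (φ - q) * f q + (φ - q) ^ 2 * deriv f q)
                * (2 * f q - 4 * (φ - q) * deriv f q + (φ - q) ^ 2 * deriv (deriv f) q) * f q
              - (-2 * (φ - q) * f q + (φ - q) ^ 2 * deriv f q) ^ 2 * deriv f q) / f q ^ 2
            + (2 * μ₄ - 6) * (-3 * (φ - q) ^ 2 * deriv f q + (φ - q) ^ 3 * deriv (deriv f) q)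
            + (μ₄ + 3) * (-2 * (φ - q) * f q + (φ - q) ^ 2 * deriv f q))) := by
  have c1 := contDiffAt_deriv (n := 2) hf
  have c2 := contDiffAt_deriv (n := 1) c1
  have d0 : HasDerivAt f (deriv f q) q := (hf.differentiableAt (by norm_num)).hasDerivAt
  have d1 : HasDerivAt (deriv f) (deriv (deriv f) q) q :=
    (c1.differentiableAt (by norm_num)).hasDerivAt
  have d2 : HasDerivAt (deriv (deriv f)) (deriv (deriv (deriv f)) q) q :=
    (c2.differentiableAt (by norm_num)).hasDerivAt
  -- The inner derivatives are differentiated again, so their formula is needed on a neighbourhood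
  -- of `q`, not only at `q`.
  have ev : (fun y =>
          μ₄ * deriv (fun t => (φ - t) ^ 4 * deriv f t) y
          - 3 * (deriv (fun t => (φ - t) ^ 2 * f t) y ^ 2 / f y)
          + (2 * μ₄ - 6) * ((φ - y) ^ 3 * deriv f y)
          + (μ₄ + 3) * ((φ - y) ^ 2 * f y)) =ᶠ[𝓝 q] fun y =>
          μ₄ * (-(4 * (φ - y) ^ 3) * deriv f y + (φ - y) ^ 4 * deriv (deriv f) y)
          - 3 * ((-(2 * (φ - y) ^ 1) * f y + (φ - y) ^ 2 * deriv f y) ^ 2 / f y)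
          + (2 * μ₄ - 6) * ((φ - y) ^ 3 * deriv f y)
          + (μ₄ + 3) * ((φ - y) ^ 2 * f y) := by
    filter_upwards [hf.eventually (by simp)] with y hy
    rw [deriv_sub_pow_mul φ 1 (hy.differentiableAt (by norm_num)), deriv_sub_pow_mul φ 3
      ((contDiffAt_deriv (n := 2) hy).differentiableAt (by norm_num))]
    push_cast
    ring
  have e1 := hasDerivAt_sub_pow φ q 0
  have e2 := hasDerivAt_sub_pow φ q 1
  have e3 := hasDerivAt_sub_pow φ q 2
  have e4 := hasDerivAt_sub_pow φ q 3
  have D := ((((((e3.const_mul 4).fun_neg.fun_mul d1).fun_add (e4.fun_mul d2)).const_mul μ₄).fun_sub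
    ((((((e1.const_mul 2).fun_neg.fun_mul d0).fun_add (e2.fun_mul d1)).fun_pow 2).fun_div d0 h0).const_mul
      3)).fun_add ((e3.fun_mul d1).const_mul (2 * μ₄ - 6))).fun_add ((e2.fun_mul d0).const_mul (μ₄ + 3))
  rw [expansion4, deriv_sub_pow_mul φ 1 (hf.differentiableAt (by norm_num)),
    deriv_sub_pow_mul φ 2 d1.differentiableAt, ev.deriv_eq, D.deriv]
  push_cast
  field_simp
  ring

end Expansion

/-! ### Minimisers of the third-order expansion -/

section Minimisers

/-- The local minimisers of a genuine cubic without constant term. -/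
theorem isLocalMin_cubic_iff {g : ℝ → ℝ} {p q c A B C : ℝ}
    (hg : ∀ x, g x = c + C * (x - q) + B * (x - q) ^ 2 + A * (x - q) ^ 3) (hA : A ≠ 0) :
    IsLocalMin g p ↔ 3 * A * (p - q) ^ 2 + 2 * B * (p - q) + C = 0 ∧ 0 < 3 * A * (p - q) + B := by
  -- Exact Taylor formula at `p`: the first bracket is `g'(p)`, and `3 * A * (p - q) + B` is half of
  -- `g''(p)`.
  have hexp : ∀ x, g x - g p = (x - p) * (3 * A * (p - q) ^ 2 + 2 * B * (p - q) + C)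
      + (x - p) ^ 2 * (3 * A * (p - q) + B + A * (x - p)) := fun x => by
    rw [hg, hg]; ring
  have hd : HasDerivAt g (3 * A * (p - q) ^ 2 + 2 * B * (p - q) + C) p := by
    have h1 : HasDerivAt (fun x : ℝ => x - q) 1 p := (hasDerivAt_id p).sub_const q
    have h2 := (((h1.const_mul C).const_add c).fun_add ((h1.fun_pow 2).const_mul B)).fun_add
      ((h1.fun_pow 3).const_mul A)
    rw [funext hg]
    convert! h2 using 1
    push_cast
    ring
  have hcont : ∀ b a : ℝ, Tendsto (fun x : ℝ => b + a * (x - p)) (𝓝 p) (𝓝 b) := fun b a => by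
    have : Continuous fun x : ℝ => b + a * (x - p) := by fun_prop
    simpa using this.tendsto p
  constructor
  · intro h
    have h0 := h.hasDerivAt_eq_zero hd
    refine ⟨h0, ?_⟩
    by_contra! hneg
    rcases hneg.lt_or_eq with hlt | heq
    · have h1 := (hcont _ A).eventually (eventually_lt_nhds hlt)
      have h2 : ∀ᶠ x in 𝓝 p, x = p := by
        filter_upwards [h1, h] with x hx hx'
        by_contra hne
        have := hexp x
        rw [h0] at this
        have : 0 < (x - p) ^ 2 := by have := sub_ne_zero.2 hne; positivity
        nlinarith
      have h3 := (h2.filter_mono nhdsWithin_le_nhds).and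
        (self_mem_nhdsWithin : Set.Ioi p ∈ 𝓝[>] p)
      obtain ⟨x, hx, hx'⟩ := h3.exists
      exact (ne_of_gt hx') hx
    -- If the second derivative vanishes too, `g x - g p = A (x - p)³` changes sign at `p`; the sign
    -- of `A` decides on which side it is negative.
    · have key : ∀ᶠ x in 𝓝 p, 0 ≤ A * (x - p) ^ 3 := by
        filter_upwards [h] with x hx
        have := hexp x
        rw [h0, heq] at this
        linarith
      rcases hA.lt_or_gt with hA | hA
      · obtain ⟨x, hx, hx'⟩ := ((key.filter_mono nhdsWithin_le_nhds).and
          (self_mem_nhdsWithin : Set.Ioi p ∈ 𝓝[>] p)).exists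
        have h4 : 0 < (x - p) ^ 3 := pow_pos (sub_pos.2 hx') 3
        nlinarith
      · obtain ⟨x, hx, hx'⟩ := ((key.filter_mono nhdsWithin_le_nhds).and
          (self_mem_nhdsWithin : Set.Iio p ∈ 𝓝[<] p)).exists
        have h4 : (x - p) ^ 3 < 0 := Odd.pow_neg (by decide) (sub_neg.2 hx')
        nlinarith
  · rintro ⟨h0, hpos⟩
    filter_upwards [(hcont _ A).eventually (eventually_gt_nhds hpos)] with x hx
    have := hexp x
    rw [h0] at this
    have : 0 ≤ (x - p) ^ 2 * (3 * A * (p - q) + B + A * (x - p)) := by positivity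
    linarith

/-- The global minimisers of a polynomial of degree at most two, not constant at second order. -/
theorem isMinOn_quadratic_iff {g : ℝ → ℝ} {p q c B C : ℝ}
    (hg : ∀ x, g x = c + C * (x - q) + B * (x - q) ^ 2) (hC : C ≠ 0) :
    IsMinOn g Set.univ p ↔ 0 < B ∧ p = q - C / (2 * B) := by
  constructor
  · intro h
    have hle : ∀ x, g p ≤ g x := fun x => h (Set.mem_univ x)
    have h0 : C + 2 * B * (p - q) = 0 := by
      have h1 : HasDerivAt (fun x : ℝ => x - q) 1 p := (hasDerivAt_id p).sub_const q
      have h2 := ((h1.const_mul C).const_add c).fun_add ((h1.fun_pow 2).const_mul B)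
      rw [← funext hg] at h2
      have h3 := (h.isLocalMin Filter.univ_mem).hasDerivAt_eq_zero h2
      push_cast at h3
      linarith
    have hB : 0 ≤ B := by
      -- At a stationary point the increment `g (p + 1) - g p` is exactly `B`.
      have h1 := hle (p + 1)
      rw [hg, hg] at h1
      nlinarith
    have hB0 : B ≠ 0 := by
      rintro rfl
      apply hC
      linarith
    refine ⟨lt_of_le_of_ne hB hB0.symm, ?_⟩
    field_simp
    linarith
  · rintro ⟨hB, rfl⟩ x -
    have h1 : g x - g (q - C / (2 * B)) = B * (x - (q - C / (2 * B))) ^ 2 := by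
      rw [hg, hg]
      field_simp
      ring
    have : 0 ≤ B * (x - (q - C / (2 * B))) ^ 2 := by positivity
    simp only [Set.mem_ofPred_eq]
    linarith

variable {f : ℝ → ℝ} {q : ℝ}

theorem isLocalMin_expansion3_iff (hf : ContDiffAt ℝ 3 f q) (h0 : 0 < f q) {μ₃ σ φ : ℝ}
    (hσ : 0 < σ) (hμ : μ₃ * deriv (deriv f) q ≠ 0) :
    IsLocalMin (expansion3 f q μ₃ σ) φ ↔
      0 < discr (f q) (deriv f q) (deriv (deriv f) q) (1 / (σ * μ₃)) ∧
      φ = q + (deriv (deriv f) q)⁻¹ * ((1 - 1 / (σ * μ₃)) * deriv f q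
        - Real.sign μ₃ * Real.sqrt (discr (f q) (deriv f q) (deriv (deriv f) q)
          (1 / (σ * μ₃)))) := by
  have hμ0 : μ₃ ≠ 0 := left_ne_zero_of_mul hμ
  have h20 : deriv (deriv f) q ≠ 0 := right_ne_zero_of_mul hμ
  have hcub : ∀ x, expansion3 f q μ₃ σ x = q + σ ^ 2 * (x - q)
      + (-(σ ^ 2 * (1 - σ * μ₃) * deriv f q / (2 * f q))) * (x - q) ^ 2
      + (-(σ ^ 3 * μ₃ * deriv (deriv f) q / (6 * f q))) * (x - q) ^ 3 := fun x => by
    rw [expansion3_eq hf]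
    field_simp
    ring
  rw [isLocalMin_cubic_iff hcub (by
    simp only [neg_ne_zero]; positivity)]
  generalize deriv (deriv f) q = a₂ at *
  generalize deriv f q = a₁ at *
  generalize f q = a at *
  set s := σ * μ₃ with hs
  have hs0 : s ≠ 0 := mul_ne_zero hσ.ne' hμ0
  set D := discr a a₁ a₂ (1 / s) with hD
  -- Completing the square: stationarity becomes `u ^ 2 = D` and convexity becomes `μ₃ * u < 0`.
  -- Thus `D > 0`, and the sign of `μ₃` selects the root.
  set u := a₂ * (φ - q) - (1 - 1 / s) * a₁ with hu
  have e1 : 3 * (-(σ ^ 3 * μ₃ * a₂ / (6 * a))) * (φ - q) ^ 2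
      + 2 * (-(σ ^ 2 * (1 - s) * a₁ / (2 * a))) * (φ - q) + σ ^ 2
      = -(σ ^ 2 * s / (2 * a * a₂)) * (u ^ 2 - D) := by
    rw [hD, hu, discr, show σ ^ 3 * μ₃ * a₂ = σ ^ 2 * s * a₂ by rw [hs]; ring]
    field_simp
    ring
  have e2 : 3 * (-(σ ^ 3 * μ₃ * a₂ / (6 * a))) * (φ - q) + -(σ ^ 2 * (1 - s) * a₁ / (2 * a))
      = -(σ ^ 3 / (2 * a)) * (μ₃ * u) := by
    rw [hu, show (1 - 1 / s) * a₁ = -((1 - s) * a₁ / s) by field_simp; ring, hs]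
    field_simp
    ring
  have k1 : (-(σ ^ 2 * s / (2 * a * a₂)) * (u ^ 2 - D) = 0) ↔ u ^ 2 = D := by
    rw [mul_eq_zero, sub_eq_zero, or_iff_right (neg_ne_zero.2 (by positivity))]
  have k2 : 0 < -(σ ^ 3 / (2 * a)) * (μ₃ * u) ↔ μ₃ * u < 0 := by
    rw [neg_mul_comm, mul_pos_iff_of_pos_left (by positivity), neg_pos]
  have k3 : φ = q + a₂⁻¹ * ((1 - 1 / s) * a₁ - Real.sign μ₃ * Real.sqrt D) ↔
      u = -(Real.sign μ₃ * Real.sqrt D) := by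
    rw [hu]
    constructor
    · rintro h
      rw [h]
      field_simp
      ring
    · intro h
      rw [show (1 - 1 / s) * a₁ - Real.sign μ₃ * Real.sqrt D = a₂ * (φ - q) by linarith,
        inv_mul_cancel_left₀ h20]
      ring
  rw [e1, e2, k1, k2, k3]
  constructor
  · rintro ⟨h1, h2⟩
    have hu0 : u ≠ 0 := right_ne_zero_of_mul h2.ne
    refine ⟨by rw [← h1]; positivity, ?_⟩
    rw [← h1, Real.sqrt_sq_eq_abs]
    rcases hμ0.lt_or_gt with h | h
    · have : 0 < u := by nlinarith
      rw [Real.sign_of_neg h, abs_of_pos this]; ring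
    · have : u < 0 := by nlinarith
      rw [Real.sign_of_pos h, abs_of_neg this]; ring
  · rintro ⟨h1, h2⟩
    have hsq := Real.sq_sqrt h1.le
    have hpos := Real.sqrt_pos.2 h1
    rcases hμ0.lt_or_gt with h | h
    · rw [Real.sign_of_neg h] at h2
      rw [h2]
      constructor <;> nlinarith
    · rw [Real.sign_of_pos h] at h2
      rw [h2]
      constructor <;> nlinarith

theorem eventually_discr_pos {a a₁ a₂ μ₃ : ℝ} (hμ : μ₃ ≠ 0) (h1 : a₁ ≠ 0) :
    ∀ᶠ σ : ℝ in 𝓝[>] 0, 0 < discr a a₁ a₂ (1 / (σ * μ₃)) := by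
  -- `1 / (σ * μ₃)` blows up, so the discriminant is rescaled by `(σ * μ₃) ^ 2`, after which it
  -- tends to `a₁ ^ 2 > 0`.
  have ht : Tendsto (fun σ : ℝ => (σ * μ₃ - 1) ^ 2 * a₁ ^ 2 + 2 * (σ * μ₃) * a₂ * a) (𝓝[>] 0)
      (𝓝 (a₁ ^ 2)) := by
    have : Continuous fun σ : ℝ => (σ * μ₃ - 1) ^ 2 * a₁ ^ 2 + 2 * (σ * μ₃) * a₂ * a := by fun_prop
    have h2 := this.tendsto 0
    norm_num at h2
    exact h2.mono_left nhdsWithin_le_nhds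
  filter_upwards [ht.eventually (eventually_gt_nhds (by positivity)), self_mem_nhdsWithin]
    with σ h2 hσ
  have hσ' : σ ≠ 0 := ne_of_gt hσ
  have : discr a a₁ a₂ (1 / (σ * μ₃))
      = ((σ * μ₃ - 1) ^ 2 * a₁ ^ 2 + 2 * (σ * μ₃) * a₂ * a) / (σ * μ₃) ^ 2 := by
    rw [discr]
    field_simp
  rw [this]
  positivity

theorem isMinOn_expansion3_iff (hf : ContDiffAt ℝ 3 f q) (h0 : 0 < f q) {μ₃ σ φ : ℝ}
    (hσ : 0 < σ) (hμ : μ₃ * deriv (deriv f) q = 0) :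
    IsMinOn (expansion3 f q μ₃ σ) Set.univ φ ↔
      (1 - σ * μ₃) * deriv f q < 0 ∧ φ = q + f q / ((1 - σ * μ₃) * deriv f q) := by
  have hquad : ∀ x, expansion3 f q μ₃ σ x = q + σ ^ 2 * (x - q)
      + (-(σ ^ 2 * ((1 - σ * μ₃) * deriv f q) / (2 * f q))) * (x - q) ^ 2 := fun x => by
    rw [expansion3_eq hf]
    field_simp
    linear_combination (-(2 * σ ^ 3 * (x - q) ^ 3)) * hμ
  rw [isMinOn_quadratic_iff hquad (by positivity)]
  generalize (1 - σ * μ₃) * deriv f q = b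
  generalize f q = a at *
  have k : 0 < -(σ ^ 2 * b / (2 * a)) ↔ b < 0 := by
    rw [mul_div_right_comm, ← mul_neg, mul_pos_iff_of_pos_left (by positivity), neg_pos]
  rw [k]
  refine and_congr_right fun hb => ?_
  have : -(σ ^ 2 / (2 * -(σ ^ 2 * b / (2 * a)))) = a / b := by
    have := hb.ne
    field_simp
  rw [sub_eq_add_neg, this]

end Minimisers

/-! ### Averaging an expansion over a random perturbation -/

section Averaging

/-- A bounded function with an expansion at the origin is globally close to its Taylor
polynomial. -/
theorem HasExp.exists_global_bound {g : ℝ → ℝ} {c₀ c₁ c₂ c₃ c₄ B ε : ℝ}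
    (H : HasExp g c₀ c₁ c₂ c₃ c₄) (hB : ∀ s, |g s| ≤ B) (hε : 0 < ε) :
    ∃ C, 0 ≤ C ∧ ∀ w, |g w - (c₀ + c₁ * w + c₂ * w ^ 2 + c₃ * w ^ 3 + c₄ * w ^ 4)|
      ≤ ε * w ^ 4 + C * w ^ 6 := by
  obtain ⟨r, hr, hball⟩ := Metric.eventually_nhds_iff.1 (H.def hε)
  set δ := min r 1 with hδ
  have hδ0 : 0 < δ := lt_min hr one_pos
  have hδ1 : δ ≤ 1 := min_le_right _ _
  have hB0 : 0 ≤ B := (abs_nonneg _).trans (hB 0)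
  set K := B + |c₀| + |c₁| + |c₂| + |c₃| + |c₄| with hK
  -- Beyond `δ ≤ 1`, each of `g w` and the monomials up to degree four is at most its coefficient
  -- bound times `(|w| / δ) ^ 6`. The exponent six is even, so no absolute value remains when the
  -- bound is integrated.
  refine ⟨K / δ ^ 6, by positivity, fun w => ?_⟩
  have hw6 : w ^ 6 = |w| ^ 6 := by rw [Even.pow_abs (by decide)]
  rcases lt_or_ge |w| δ with hw | hw
  · have h1 := hball (y := w) (by
      rw [Real.dist_eq, sub_zero]; exact hw.trans_le (min_le_left _ _))
    rw [Real.norm_eq_abs, Real.norm_of_nonneg (by positivity)] at h1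
    have : 0 ≤ K / δ ^ 6 * w ^ 6 := by positivity
    linarith
  · set t := |w| / δ with ht
    have ht1 : 1 ≤ t := (one_le_div hδ0).2 hw
    have hwt : |w| = δ * t := by rw [ht]; field_simp
    have hpow : ∀ i ≤ 6, |w| ^ i ≤ t ^ 6 := fun i hi => by
      rw [hwt, mul_pow]
      calc δ ^ i * t ^ i ≤ 1 * t ^ 6 := by
            gcongr
            · exact pow_le_one₀ hδ0.le hδ1
        _ = t ^ 6 := one_mul _
    have hC : K / δ ^ 6 * w ^ 6 = K * t ^ 6 := by
      rw [hw6, hwt]; field_simp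
    have hmono : ∀ c : ℝ, ∀ i ≤ 6, |c * w ^ i| ≤ |c| * t ^ 6 := fun c i hi => by
      rw [abs_mul, abs_pow]
      exact mul_le_mul_of_nonneg_left (hpow i hi) (abs_nonneg c)
    have e0 := hmono c₀ 0 (by norm_num)
    have e1 := hmono c₁ 1 (by norm_num)
    have e2 := hmono c₂ 2 (by norm_num)
    have e3 := hmono c₃ 3 (by norm_num)
    have e4 := hmono c₄ 4 (by norm_num)
    have eB : |g w| ≤ B * t ^ 6 := (hB w).trans (le_mul_of_one_le_right hB0 (one_le_pow₀ ht1))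
    rw [pow_zero, mul_one] at e0
    rw [pow_one] at e1
    have hε4 : 0 ≤ ε * w ^ 4 := by positivity
    rw [hC, hK]
    refine le_add_of_nonneg_of_le hε4 ?_
    rw [abs_le] at *
    constructor <;> nlinarith

variable {Ω : Type*} [MeasurableSpace Ω] {P : Measure Ω} {Y : Ω → ℝ}

theorem add_mul_exp_pow (x v s y : ℝ) (n : ℕ) :
    (x + v * Real.exp (-(s * y))) ^ n
      = ∑ j ∈ Finset.range (n + 1), (v ^ j * x ^ (n - j) * n.choose j) * Real.exp (-j * s * y) := by
  rw [add_comm, add_pow]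
  refine Finset.sum_congr rfl fun j _ => ?_
  rw [mul_pow, ← Real.exp_nat_mul, show (j : ℝ) * -(s * y) = -j * s * y by ring]
  ring

theorem integrable_add_mul_exp_pow {s : ℝ} {n : ℕ}
    (h : ∀ j ∈ Finset.range (n + 1), Integrable (fun ω => Real.exp (-j * s * Y ω)) P) (x v : ℝ) :
    Integrable (fun ω => (x + v * Real.exp (-(s * Y ω))) ^ n) P := by
  simp only [add_mul_exp_pow]
  exact integrable_finsetSum _ fun j hj => (h j hj).const_mul _

theorem integral_add_mul_exp_pow {s : ℝ} {n : ℕ}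
    (h : ∀ j ∈ Finset.range (n + 1), Integrable (fun ω => Real.exp (-j * s * Y ω)) P) (x v : ℝ) :
    ∫ ω, (x + v * Real.exp (-(s * Y ω))) ^ n ∂P
      = ∑ j ∈ Finset.range (n + 1), (v ^ j * x ^ (n - j) * n.choose j) * mgf Y P (-j * s) := by
  simp only [add_mul_exp_pow]
  rw [integral_finsetSum _ fun j hj => (h j hj).const_mul _]
  simp only [integral_const_mul, mgf]

theorem eventually_integrable_exp_le (h0 : 0 ∈ interior (integrableExpSet Y P)) (n : ℕ) :
    ∀ᶠ s : ℝ in 𝓝 0, ∀ k ≤ n, ∀ j ∈ Finset.range (k + 1),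
      Integrable (fun ω => Real.exp (-j * s * Y ω)) P := by
  suffices h : ∀ᶠ s : ℝ in 𝓝 0, ∀ j ∈ Finset.range (n + 1),
      Integrable (fun ω => Real.exp (-j * s * Y ω)) P from h.mono fun s hs k hk j hj =>
    hs j (Finset.mem_range.2 (by have := Finset.mem_range.1 hj; omega))
  rw [Finset.eventually_all]
  intro j _
  have ht : Tendsto (fun s : ℝ => -(j : ℝ) * s) (𝓝 0) (𝓝 0) := by
    have : Continuous fun s : ℝ => -(j : ℝ) * s := by fun_prop
    simpa using this.tendsto 0
  exact ht.eventually (mem_interior_iff_mem_nhds.1 h0)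

/-- Expansions of the moments of a small log-linear perturbation of the origin. -/
theorem HasExp.integral_pow [IsProbabilityMeasure P]
    (h0 : 0 ∈ interior (integrableExpSet Y P)) (hY1 : ∫ ω, Y ω ∂P = 0)
    (hY2 : ∫ ω, Y ω ^ 2 ∂P = 1) {m₃ m₄ : ℝ} (hY3 : ∫ ω, Y ω ^ 3 ∂P = m₃)
    (hY4 : ∫ ω, Y ω ^ 4 ∂P = m₄) {v : ℝ → ℝ} {x v₂ v₃ v₄ : ℝ}
    (hv : HasExp v (-x) 0 v₂ v₃ v₄) :
    HasExp (fun s => ∫ ω, (x + v s * Real.exp (-(s * Y ω))) ^ 1 ∂P) 0 0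
      (v₂ - x / 2) (v₃ + x * m₃ / 6) (v₄ + v₂ / 2 - x * m₄ / 24) ∧
    HasExp (fun s => ∫ ω, (x + v s * Real.exp (-(s * Y ω))) ^ 2 ∂P) 0 0
      (x ^ 2) (-x ^ 2 * m₃) (v₂ ^ 2 - 3 * x * v₂ + 7 / 12 * x ^ 2 * m₄) ∧
    HasExp (fun s => ∫ ω, (x + v s * Real.exp (-(s * Y ω))) ^ 3 ∂P) 0 0 0
      (x ^ 3 * m₃) (3 * x ^ 2 * v₂ - 3 / 2 * x ^ 3 * m₄) ∧
    HasExp (fun s => ∫ ω, (x + v s * Real.exp (-(s * Y ω))) ^ 4 ∂P) 0 0 0 0 (x ^ 4 * m₄) ∧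
    HasExp (fun s => ∫ ω, (x + v s * Real.exp (-(s * Y ω))) ^ 6 ∂P) 0 0 0 0 0 := by
  have hM := hasExp_mgf h0 hY1 hY2
  rw [hY3, hY4] at hM
  obtain ⟨V2, V3, V4, V5, V6⟩ := hv.pow_two_to_six
  have J1 := hv.mul (hM.comp_mul (-1))
  have J2 := V2.mul (hM.comp_mul (-2))
  have J3 := V3.mul (hM.comp_mul (-3))
  have J4 := V4.mul (hM.comp_mul (-4))
  have J5 := V5.mul (hM.comp_mul (-5))
  have J6 := V6.mul (hM.comp_mul (-6))
  have hev : ∀ᶠ s : ℝ in 𝓝 0, ∀ n ≤ 6, ∀ j ∈ Finset.range (n + 1),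
      Integrable (fun ω => Real.exp (-j * s * Y ω)) P := eventually_integrable_exp_le h0 6
  refine ⟨?_, ?_, ?_, ?_, ?_⟩
  · refine (((HasExp.const x).add J1).congr ?_).congr_coeff ?_ ?_ ?_ ?_ ?_
    · filter_upwards [hev] with s hs
      rw [integral_add_mul_exp_pow (hs 1 (by norm_num))]
      simp [Finset.sum_range_succ]
    all_goals ring
  · refine ((((HasExp.const (x ^ 2)).add (J1.const_mul (2 * x))).add J2).congr ?_).congr_coeff
      ?_ ?_ ?_ ?_ ?_
    · filter_upwards [hev] with s hs
      rw [integral_add_mul_exp_pow (hs 2 (by norm_num))]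
      simp [Finset.sum_range_succ]
      ring
    all_goals ring
  · refine (((((HasExp.const (x ^ 3)).add (J1.const_mul (3 * x ^ 2))).add
      (J2.const_mul (3 * x))).add J3).congr ?_).congr_coeff ?_ ?_ ?_ ?_ ?_
    · filter_upwards [hev] with s hs
      rw [integral_add_mul_exp_pow (hs 3 (by norm_num))]
      simp [Finset.sum_range_succ, Nat.choose]
      ring
    all_goals ring
  · refine ((((((HasExp.const (x ^ 4)).add (J1.const_mul (4 * x ^ 3))).add
      (J2.const_mul (6 * x ^ 2))).add (J3.const_mul (4 * x))).add J4).congr ?_).congr_coeff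
      ?_ ?_ ?_ ?_ ?_
    · filter_upwards [hev] with s hs
      rw [integral_add_mul_exp_pow (hs 4 (by norm_num))]
      simp [Finset.sum_range_succ, Nat.choose]
      ring
    all_goals ring
  · refine ((((((((HasExp.const (x ^ 6)).add (J1.const_mul (6 * x ^ 5))).add
      (J2.const_mul (15 * x ^ 4))).add (J3.const_mul (20 * x ^ 3))).add
      (J4.const_mul (15 * x ^ 2))).add (J5.const_mul (6 * x))).add J6).congr ?_).congr_coeff
      ?_ ?_ ?_ ?_ ?_
    · filter_upwards [hev] with s hs
      rw [integral_add_mul_exp_pow (hs 6 (by norm_num))]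
      simp [Finset.sum_range_succ, Nat.choose]
      ring
    all_goals ring

/-- Expansion of the mean of a bounded function of a small log-linear perturbation. -/
theorem HasExp.integral_comp [IsProbabilityMeasure P] (hY : Measurable Y)
    (h0 : 0 ∈ interior (integrableExpSet Y P)) (hY1 : ∫ ω, Y ω ∂P = 0)
    (hY2 : ∫ ω, Y ω ^ 2 ∂P = 1) {m₃ m₄ : ℝ} (hY3 : ∫ ω, Y ω ^ 3 ∂P = m₃)
    (hY4 : ∫ ω, Y ω ^ 4 ∂P = m₄) {g v : ℝ → ℝ} {c₀ c₁ c₂ c₃ c₄ B x v₂ v₃ v₄ : ℝ}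
    (H : HasExp g c₀ c₁ c₂ c₃ c₄) (hgm : Measurable g) (hB : ∀ s, |g s| ≤ B)
    (hv : HasExp v (-x) 0 v₂ v₃ v₄) :
    HasExp (fun s => ∫ ω, g (x + v s * Real.exp (-(s * Y ω))) ∂P) c₀ 0
      (c₁ * (v₂ - x / 2) + c₂ * x ^ 2)
      (c₁ * (v₃ + x * m₃ / 6) - c₂ * x ^ 2 * m₃ + c₃ * x ^ 3 * m₃)
      (c₁ * (v₄ + v₂ / 2 - x * m₄ / 24) + c₂ * (v₂ ^ 2 - 3 * x * v₂ + 7 / 12 * x ^ 2 * m₄)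
        + c₃ * (3 * x ^ 2 * v₂ - 3 / 2 * x ^ 3 * m₄) + c₄ * x ^ 4 * m₄) := by
  obtain ⟨W1, W2, W3, W4, W6⟩ := hv.integral_pow h0 hY1 hY2 hY3 hY4
  have hev := eventually_integrable_exp_le h0 6
  have T := ((((HasExp.const c₀).add (W1.const_mul c₁)).add (W2.const_mul c₂)).add
    (W3.const_mul c₃)).add (W4.const_mul c₄)
  have hR : (fun s => ∫ ω, g (x + v s * Real.exp (-(s * Y ω))) ∂P
      - (c₀ + c₁ * (∫ ω, (x + v s * Real.exp (-(s * Y ω))) ^ 1 ∂P)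
        + c₂ * (∫ ω, (x + v s * Real.exp (-(s * Y ω))) ^ 2 ∂P)
        + c₃ * (∫ ω, (x + v s * Real.exp (-(s * Y ω))) ^ 3 ∂P)
        + c₄ * (∫ ω, (x + v s * Real.exp (-(s * Y ω))) ^ 4 ∂P))) =o[𝓝 0] fun s => s ^ 4 := by
    rw [isLittleO_iff]
    intro ε hε
    obtain ⟨K, hK, hW4⟩ := W4.isBigO_pow_four.exists_pos
    rw [isBigOWith_iff] at hW4
    -- With `E[W⁴] ≤ K s⁴`, the factor `ε / (2 * K)` spends half of `ε`. The other half covers `C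
    -- E[W⁶]`, as `E[W⁶] = o(s⁴)`; `C + 1` avoids dividing by zero.
    obtain ⟨C, hC, hbd⟩ := H.exists_global_bound hB (show 0 < ε / (2 * K) by positivity)
    have hW6 := W6.isLittleO_pow_four.def (show 0 < ε / (2 * (C + 1)) by positivity)
    filter_upwards [hev, hW4, hW6] with s hs h4 h6
    set W : Ω → ℝ := fun ω => x + v s * Real.exp (-(s * Y ω)) with hW
    have hWm : Measurable W := by fun_prop
    have i1 : Integrable (fun ω => W ω ^ 1) P := integrable_add_mul_exp_pow (hs 1 (by norm_num)) _ _
    have i2 : Integrable (fun ω => W ω ^ 2) P := integrable_add_mul_exp_pow (hs 2 (by norm_num)) _ _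
    have i3 : Integrable (fun ω => W ω ^ 3) P := integrable_add_mul_exp_pow (hs 3 (by norm_num)) _ _
    have i4 : Integrable (fun ω => W ω ^ 4) P := integrable_add_mul_exp_pow (hs 4 (by norm_num)) _ _
    have i6 : Integrable (fun ω => W ω ^ 6) P := integrable_add_mul_exp_pow (hs 6 (by norm_num)) _ _
    have ig : Integrable (fun ω => g (W ω)) P :=
      Integrable.of_bound (hgm.comp hWm).aestronglyMeasurable B (ae_of_all _ fun ω => hB _)
    have iT : Integrable (fun ω => c₀ + c₁ * W ω ^ 1 + c₂ * W ω ^ 2 + c₃ * W ω ^ 3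
        + c₄ * W ω ^ 4) P :=
      ((((integrable_const c₀).add (i1.const_mul c₁)).add (i2.const_mul c₂)).add
        (i3.const_mul c₃)).add (i4.const_mul c₄)
    have eT : ∫ ω, (c₀ + c₁ * W ω ^ 1 + c₂ * W ω ^ 2 + c₃ * W ω ^ 3 + c₄ * W ω ^ 4) ∂P
        = c₀ + c₁ * (∫ ω, W ω ^ 1 ∂P) + c₂ * (∫ ω, W ω ^ 2 ∂P) + c₃ * (∫ ω, W ω ^ 3 ∂P)
          + c₄ * (∫ ω, W ω ^ 4 ∂P) := by
      rw [integral_add (by fun_prop) (by fun_prop), integral_add (by fun_prop) (by fun_prop),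
        integral_add (by fun_prop) (by fun_prop), integral_add (by fun_prop) (by fun_prop)]
      simp only [integral_const_mul, integral_const, probReal_univ, one_smul]
    rw [← eT, ← integral_sub ig iT]
    have n4 : 0 ≤ ∫ ω, W ω ^ 4 ∂P := integral_nonneg fun ω => by positivity
    have n6 : 0 ≤ ∫ ω, W ω ^ 6 ∂P := integral_nonneg fun ω => by positivity
    rw [Real.norm_of_nonneg n4, Real.norm_of_nonneg (by positivity)] at h4
    rw [Real.norm_of_nonneg n6, Real.norm_of_nonneg (by positivity)] at h6
    rw [Real.norm_of_nonneg (show 0 ≤ s ^ 4 by positivity)]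
    calc ‖∫ ω, g (W ω) - (c₀ + c₁ * W ω ^ 1 + c₂ * W ω ^ 2 + c₃ * W ω ^ 3 + c₄ * W ω ^ 4) ∂P‖
        ≤ ∫ ω, (ε / (2 * K) * W ω ^ 4 + C * W ω ^ 6) ∂P := by
          refine norm_integral_le_of_norm_le ((i4.const_mul _).add (i6.const_mul _))
            (ae_of_all _ fun ω => ?_)
          simpa using hbd (W ω)
      _ = ε / (2 * K) * (∫ ω, W ω ^ 4 ∂P) + C * (∫ ω, W ω ^ 6 ∂P) := by
          rw [integral_add (i4.const_mul _) (i6.const_mul _), integral_const_mul,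
            integral_const_mul]
      _ ≤ ε / (2 * K) * (K * s ^ 4) + (C + 1) * (ε / (2 * (C + 1)) * s ^ 4) := by
          gcongr
          linarith
      _ = ε * s ^ 4 := by field_simp; ring
  refine (T.of_sub_isLittleO hR).congr_coeff ?_ ?_ ?_ ?_ ?_
  all_goals ring

end Averaging

/-! ### Distribution function and quantile of the claim -/

section Density

variable {ν : Measure ℝ} {f : ℝ → ℝ}

theorem integrable_of_withDensity [IsProbabilityMeasure ν] (hf : Measurable f) (hf0 : ∀ x, 0 ≤ f x)
    (hν : ν = volume.withDensity fun x => ENNReal.ofReal (f x)) : Integrable f := by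
  refine ⟨hf.aestronglyMeasurable, ?_⟩
  rw [hasFiniteIntegral_iff_ofReal (ae_of_all _ hf0), ← setLIntegral_univ,
    ← withDensity_apply _ MeasurableSet.univ, ← hν]
  exact measure_lt_top _ _

theorem cdf_sub_cdf [IsProbabilityMeasure ν] (hf : Measurable f) (hf0 : ∀ x, 0 ≤ f x)
    (hν : ν = volume.withDensity fun x => ENNReal.ofReal (f x)) (a x : ℝ) :
    cdf ν x - cdf ν a = ∫ t in a..x, f t := by
  have hint := integrable_of_withDensity hf hf0 hν
  have h : ∀ x, cdf ν x = ∫ t in Set.Iic x, f t := fun x => by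
    rw [cdf_eq_real, Measure.real, hν, withDensity_apply _ measurableSet_Iic,
      integral_eq_lintegral_of_nonneg_ae (ae_of_all _ hf0) hf.aestronglyMeasurable]
  rw [h, h, intervalIntegral.integral_Iic_sub_Iic hint.integrableOn hint.integrableOn]

theorem continuous_cdf [IsProbabilityMeasure ν] (hf : Measurable f) (hf0 : ∀ x, 0 ≤ f x)
    (hν : ν = volume.withDensity fun x => ENNReal.ofReal (f x)) : Continuous (cdf ν) := by
  have hint := integrable_of_withDensity hf hf0 hν
  have h : (cdf ν : ℝ → ℝ) = fun x => cdf ν 0 + ∫ t in (0 : ℝ)..x, f t := by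
    ext x
    rw [← cdf_sub_cdf hf hf0 hν 0 x]
    ring
  rw [h]
  exact (intervalIntegral.continuous_primitive (fun a b => hint.intervalIntegrable) 0).const_add _

theorem hasDerivAt_cdf [IsProbabilityMeasure ν] (hf : Measurable f) (hf0 : ∀ x, 0 ≤ f x)
    (hν : ν = volume.withDensity fun x => ENNReal.ofReal (f x)) {y : ℝ} (hy : ContinuousAt f y) :
    HasDerivAt (cdf ν) (f y) y := by
  have hint := integrable_of_withDensity hf hf0 hν
  have h : (cdf ν : ℝ → ℝ) = fun x => cdf ν 0 + ∫ t in (0 : ℝ)..x, f t := by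
    ext x
    rw [← cdf_sub_cdf hf hf0 hν 0 x]
    ring
  rw [h]
  exact (intervalIntegral.integral_hasDerivAt_right hint.intervalIntegrable
    hf.stronglyMeasurable.stronglyMeasurableAtFilter hy).const_add _

theorem hasExp_cdf [IsProbabilityMeasure ν] (hf : Measurable f) (hf0 : ∀ x, 0 ≤ f x)
    (hν : ν = volume.withDensity fun x => ENNReal.ofReal (f x)) {q : ℝ}
    (hfq : ContDiffAt ℝ 3 f q) :
    HasExp (fun s => cdf ν (q + s)) (cdf ν q) (f q) (deriv f q / 2) (deriv (deriv f) q / 6)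
      (deriv (deriv (deriv f)) q / 24) := by
  have hd : ∀ᶠ y in 𝓝 q, HasDerivAt (cdf ν) (f y) y := by
    filter_upwards [hfq.eventually (by simp)] with y hy
    exact hasDerivAt_cdf hf hf0 hν hy.continuousAt
  have hc : ContDiffAt ℝ 4 (cdf ν) q := by
    -- The cdf has derivative `f` near `q`, hence is one order smoother than `f`.
    refine (contDiffAt_succ_iff_hasFDerivAt (n := 3)).2
      ⟨fun y => ContinuousLinearMap.toSpanSingleton ℝ (f y), ⟨_, hd, fun y hy => hy.hasFDerivAt⟩, ?_⟩
    exact (ContinuousLinearMap.toSpanSingletonCLE (𝕜 := ℝ) (E := ℝ)).contDiff.contDiffAt.comp q hfq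
  have e1 : deriv (cdf ν) =ᶠ[𝓝 q] f := hd.mono fun y hy => hy.deriv
  have e2 := e1.deriv
  have e3 := e2.deriv
  have e4 := e3.deriv
  have := ContDiffAt.hasExp hc
  rwa [e1.eq_of_nhds, e2.eq_of_nhds, e3.eq_of_nhds, e4.eq_of_nhds] at this

/-- Continuity is used twice: the superlevel set is closed, so the infimum belongs to it, and the
level `p` is attained at some `x`, which bounds the infimum from above. -/
theorem cdf_quantile (hc : Continuous (cdf ν)) {p : ℝ} (h0 : 0 < p) (h1 : p < 1) :
    cdf ν (quantile ν p) = p := by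
  have hclosed : IsClosed {x : ℝ | p ≤ cdf ν x} := isClosed_le continuous_const hc
  obtain ⟨a, ha⟩ := ((tendsto_cdf_atBot ν).eventually (eventually_lt_nhds h0)).exists
  obtain ⟨b, hb⟩ := ((tendsto_cdf_atTop ν).eventually (eventually_gt_nhds h1)).exists
  have hbdd : BddBelow {x : ℝ | p ≤ cdf ν x} := ⟨a, fun x hx => by
    by_contra! hlt
    exact absurd (hx.trans (monotone_cdf ν hlt.le)) (not_le.2 ha)⟩
  obtain ⟨x, hx⟩ := mem_range_of_exists_le_of_exists_ge hc ⟨a, ha.le⟩ ⟨b, hb.le⟩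
  refine le_antisymm ?_ (hclosed.csInf_mem ⟨b, hb.le⟩ hbdd)
  calc cdf ν (quantile ν p) ≤ cdf ν x := monotone_cdf ν (csInf_le hbdd hx.ge)
    _ = p := hx

end Density

/-! ### Exponential and polynomial moments of the normalised logarithm -/

section NormLog

variable {Ω : Type*} [MeasurableSpace Ω] {P : Measure Ω}

/-- The set of exponents with finite exponential moment is convex, so it contains all of `[-a, a]`.
-/
theorem zero_mem_interior_integrableExpSet {Y : Ω → ℝ} {a : ℝ} (ha : 0 < a)
    (h1 : Integrable (fun ω => Real.exp (a * Y ω)) P)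
    (h2 : Integrable (fun ω => Real.exp (-a * Y ω)) P) :
    0 ∈ interior (integrableExpSet Y P) := by
  rw [mem_interior_iff_mem_nhds]
  exact Filter.mem_of_superset (Icc_mem_nhds (neg_lt_zero.2 ha) ha)
    (convex_integrableExpSet.ordConnected.out h2 h1)

variable {X : Ω → ℝ}

/-- Integrability of `X` and `X⁻¹` gives `log X` exponential moments at `±1`, hence all polynomial
moments. -/
theorem memLp_log [IsProbabilityMeasure P] (hXpos : ∀ᵐ ω ∂P, 0 < X ω) (hXint : Integrable X P)
    (hXinv : Integrable (fun ω => (X ω)⁻¹) P) : MemLp (fun ω => Real.log (X ω)) 2 P := by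
  have h : 0 ∈ interior (integrableExpSet (fun ω => Real.log (X ω)) P) := by
    refine zero_mem_interior_integrableExpSet one_pos (hXint.congr ?_) (hXinv.congr ?_)
    · filter_upwards [hXpos] with ω hω
      rw [one_mul, Real.exp_log hω]
    · filter_upwards [hXpos] with ω hω
      rw [neg_one_mul, Real.exp_neg, Real.exp_log hω]
  exact_mod_cast memLp_of_mem_interior_integrableExpSet h 2

theorem zero_mem_interior_integrableExpSet_normLog [IsProbabilityMeasure P] (hXpos : ∀ᵐ ω ∂P, 0 < X ω)
    (hXint : Integrable X P) (hXinv : Integrable (fun ω => (X ω)⁻¹) P)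
    (hXvar : variance (fun ω => Real.log (X ω)) P ≠ 0) :
    0 ∈ interior (integrableExpSet (normLog P X) P) := by
  have hs : 0 < Real.sqrt (variance (fun ω => Real.log (X ω)) P) :=
    Real.sqrt_pos.2 (lt_of_le_of_ne (variance_nonneg _ _) hXvar.symm)
  refine zero_mem_interior_integrableExpSet hs
    ((hXint.mul_const (Real.exp (-∫ ω', Real.log (X ω') ∂P))).congr ?_)
    ((hXinv.mul_const (Real.exp (∫ ω', Real.log (X ω') ∂P))).congr ?_)
  · filter_upwards [hXpos] with ω hω
    rw [normLog, mul_div_cancel₀ _ hs.ne', sub_eq_add_neg, Real.exp_add, Real.exp_log hω]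
  · filter_upwards [hXpos] with ω hω
    rw [normLog, neg_mul, mul_div_cancel₀ _ hs.ne', neg_sub, sub_eq_add_neg, Real.exp_add,
      Real.exp_neg, Real.exp_log hω, mul_comm]

theorem integral_normLog [IsProbabilityMeasure P] (hlog : MemLp (fun ω => Real.log (X ω)) 2 P) :
    ∫ ω, normLog P X ω ∂P = 0 := by
  have hi : Integrable (fun ω => Real.log (X ω)) P := hlog.integrable (by norm_num)
  simp only [normLog]
  rw [integral_div, integral_sub hi (integrable_const _)]
  simp

theorem integral_normLog_sq [IsProbabilityMeasure P] (hX : Measurable X)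
    (hXvar : variance (fun ω => Real.log (X ω)) P ≠ 0) :
    ∫ ω, normLog P X ω ^ 2 ∂P = 1 := by
  simp only [normLog, div_pow, Real.sq_sqrt (variance_nonneg (fun ω => Real.log (X ω)) P)]
  rw [integral_div, ← variance_eq_integral (X := fun ω => Real.log (X ω))
    (Real.measurable_log.comp hX).aemeasurable]
  exact div_self hXvar

theorem measurable_normLog (hX : Measurable X) : Measurable (normLog P X) :=
  ((Real.measurable_log.comp hX).sub_const _).div_const _

end NormLog

/-! ### Ruin probability and the sandwich for the value-at-risk -/

section ValueAtRisk

variable {Ω : Type*} [MeasurableSpace Ω] {P : Measure Ω}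

/-- The event `Z + m < 0` shrinks as `m` grows, so a capital that is too small bounds the admissible
set from below. -/
theorem VaR_mem_Icc [IsProbabilityMeasure P] {Z : Ω → ℝ} {α a b : ℝ} (ha : α < P.real {ω | Z ω + a < 0})
    (hb : P.real {ω | Z ω + b < 0} ≤ α) : VaR P α Z ∈ Set.Icc a b := by
  have hlow : ∀ m ∈ {m : ℝ | P.real {ω | Z ω + m < 0} ≤ α}, a ≤ m := fun m hm => by
    by_contra! hlt
    refine absurd (ha.trans_le ((measureReal_mono fun ω hω => ?_).trans hm)) (lt_irrefl α)
    simp only [Set.mem_ofPred_eq] at hω ⊢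
    linarith
  exact ⟨le_csInf ⟨b, hb⟩ hlow, csInf_le ⟨a, hlow⟩ hb⟩

/-- Fubini for the product law of `(Y, L)`: conditionally on `Y` the threshold is a constant. -/
theorem measureReal_comp_lt_of_indepFun [IsProbabilityMeasure P] {Y L : Ω → ℝ} (hY : Measurable Y) (hL : Measurable L)
    (hind : IndepFun Y L P) {h : ℝ → ℝ} (hh : Measurable h) :
    P.real {ω | h (Y ω) < L ω} = 1 - ∫ ω, cdf (P.map L) (h (Y ω)) ∂P := by
  have : IsProbabilityMeasure (P.map L) := Measure.isProbabilityMeasure_map hL.aemeasurable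
  have : IsProbabilityMeasure (P.map Y) := Measure.isProbabilityMeasure_map hY.aemeasurable
  have hms : MeasurableSet {p : ℝ × ℝ | p.2 ≤ h p.1} :=
    measurableSet_le measurable_snd (hh.comp measurable_fst)
  have hset : {ω | h (Y ω) < L ω} = {ω | L ω ≤ h (Y ω)}ᶜ := by
    ext ω
    simp
  have hle : P {ω | L ω ≤ h (Y ω)} = ∫⁻ ω, P.map L (Set.Iic (h (Y ω))) ∂P := by
    have h1 : {ω | L ω ≤ h (Y ω)} = (fun ω => (Y ω, L ω)) ⁻¹' {p : ℝ × ℝ | p.2 ≤ h p.1} := rfl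
    rw [h1, ← Measure.map_apply (hY.prodMk hL) hms,
      (indepFun_iff_map_prod_eq_prod_map_map hY.aemeasurable hL.aemeasurable).1 hind,
      Measure.prod_apply hms, lintegral_map (measurable_measure_prodMk_left hms) hY]
    rfl
  have hmeas : Measurable fun ω => P.map L (Set.Iic (h (Y ω))) :=
    (measurable_measure_prodMk_left hms).comp hY
  rw [hset, probReal_compl_eq_one_sub (s := {ω | L ω ≤ h (Y ω)}) (measurableSet_le hL (hh.comp hY)), Measure.real, hle]
  simp only [cdf_eq_real, Measure.real]
  rw [integral_toReal hmeas.aemeasurable (ae_of_all _ fun ω => measure_lt_top _ _)]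

theorem surplus_assetVol_add_neg_iff {X L : Ω → ℝ} {σ φ m : ℝ} (hM : 0 < mgf (normLog P X) P σ)
    (ω : Ω) :
    surplus (assetVol P X σ) L φ ω + m < 0 ↔
      φ + (m - φ) * mgf (normLog P X) P σ * Real.exp (-(σ * normLog P X ω)) < L ω := by
  rw [surplus, assetVol, Real.exp_neg]
  set e := Real.exp (σ * normLog P X ω) with he
  have he0 : 0 < e := Real.exp_pos _
  have h1 : φ * (e / mgf (normLog P X) P σ - 1) - e / mgf (normLog P X) P σ * L ω + m
      = e / mgf (normLog P X) P σ
        * (φ + (m - φ) * mgf (normLog P X) P σ * e⁻¹ - L ω) := by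
    field_simp
    ring
  rw [h1, mul_neg_iff, or_iff_left (by rintro ⟨h, -⟩; exact h.not_gt (by positivity)),
    and_iff_right (by positivity), sub_neg]

/-- The probability of ruin along a fourth-order curve of capital requirements. -/
theorem hasExp_integral_cdf [IsProbabilityMeasure P] {Y : Ω → ℝ} (hY : Measurable Y)
    (h0 : 0 ∈ interior (integrableExpSet Y P)) (hY1 : ∫ ω, Y ω ∂P = 0)
    (hY2 : ∫ ω, Y ω ^ 2 ∂P = 1) {m₃ m₄ : ℝ} (hY3 : ∫ ω, Y ω ^ 3 ∂P = m₃)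
    (hY4 : ∫ ω, Y ω ^ 4 ∂P = m₄) {ν : Measure ℝ} [IsProbabilityMeasure ν] {f : ℝ → ℝ}
    (hf : Measurable f) (hfpos : ∀ x, 0 < f x)
    (hν : ν = volume.withDensity fun x => ENNReal.ofReal (f x)) {q : ℝ}
    (hfq : ContDiffAt ℝ 3 f q) (φ ε : ℝ) :
    HasExp (fun s => ∫ ω, cdf ν (φ + (expansion4 f q m₃ m₄ s φ + ε * s ^ 4 - φ) * mgf Y P s
      * Real.exp (-(s * Y ω))) ∂P) (cdf ν q) 0 0 0 (f q * ε) := by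
  have hM := hasExp_mgf h0 hY1 hY2
  rw [hY3, hY4] at hM
  have hF := hasExp_cdf hf (fun x => (hfpos x).le) hν hfq
  have hq0 : f q ≠ 0 := (hfpos q).ne'
  simp only [expansion4_eq hfq hq0]
  generalize deriv (deriv (deriv f)) q = a₃ at *
  generalize deriv (deriv f) q = a₂ at *
  generalize deriv f q = a₁ at *
  generalize f q = a at *
  obtain ⟨x, rfl⟩ : ∃ x, φ = q + x := ⟨φ - q, by ring⟩
  simp only [add_sub_cancel_left]
  set A := -2 * x * a + x ^ 2 * a₁ with hA
  set B := -3 * x ^ 2 * a₁ + x ^ 3 * a₂ with hB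
  set C := m₄ * (12 * x ^ 2 * a₁ - 8 * x ^ 3 * a₂ + x ^ 4 * a₃)
    - 3 * (2 * A * (2 * a - 4 * x * a₁ + x ^ 2 * a₂) * a - A ^ 2 * a₁) / a ^ 2
    + (2 * m₄ - 6) * B + (m₄ + 3) * A with hC
  -- The curve `m(s) - φ`, with `x = φ - q`; multiplying by the mgf gives the deterministic factor
  -- `v` of the perturbation `x + v s * exp (-(s * Y))`.
  have hm := HasExp.poly (-x) 0 (-(A / (2 * a))) (-(m₃ * B / (6 * a))) (ε - C / (24 * a))
  have hv := hm.mul hM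
  have hv' : HasExp (fun s => (q - 1 / a * (s ^ 2 / 2 * A + s ^ 3 * m₃ / 6 * B + s ^ 4 / 24 * C)
      + ε * s ^ 4 - (q + x)) * mgf Y P s) (-x) 0 (-(A / (2 * a)) - x / 2)
      (-(m₃ * B / (6 * a)) - x * m₃ / 6) (ε - C / (24 * a) - A / (4 * a) - x * m₄ / 24) := by
    refine (hv.congr (Eventually.of_forall fun s => ?_)).congr_coeff ?_ ?_ ?_ ?_ ?_
    · congr 1
      field_simp
      ring
    all_goals ring
  have hbd : ∀ s, |cdf ν (q + s)| ≤ 1 := fun s => by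
    rw [abs_of_nonneg (cdf_nonneg _ _)]
    exact cdf_le_one _ _
  have hmeas : Measurable fun s => cdf ν (q + s) :=
    (monotone_cdf ν).measurable.comp (measurable_const_add q)
  refine ((HasExp.integral_comp hY h0 hY1 hY2 hY3 hY4 hF hmeas hbd hv').congr
    (Eventually.of_forall fun s => ?_)).congr_coeff rfl rfl ?_ ?_ ?_
  · simp only [add_assoc]
  · rw [hA]
    field_simp
    ring
  · rw [hB]
    field_simp
    ring
  · rw [hC, hB, hA]
    field_simp
    ring

theorem VaR_sub_expansion4_isLittleO [IsProbabilityMeasure P] {X L : Ω → ℝ} (hX : Measurable X) (hL : Measurable L)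
    (hXpos : ∀ᵐ ω ∂P, 0 < X ω) (hindep : IndepFun X L P)
    (hXint : Integrable X P) (hXinv : Integrable (fun ω => (X ω)⁻¹) P)
    (hXvar : variance (fun ω => Real.log (X ω)) P ≠ 0)
    {f : ℝ → ℝ} (hf : Measurable f) (hfpos : ∀ x, 0 < f x)
    (hLf : P.map L = volume.withDensity (fun x => ENNReal.ofReal (f x)))
    {α : ℝ} (hα0 : 0 < α) (hα1 : α < 1) {q : ℝ} (hq : q = quantile (P.map L) (1 - α))
    (hfq : ContDiffAt ℝ 3 f q) (φ : ℝ) :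
    (fun σ : ℝ => VaR P α (surplus (assetVol P X σ) L φ)
        - expansion4 f q (logMoment P X 3) (logMoment P X 4) σ φ)
      =o[𝓝[>] 0] (fun σ : ℝ => σ ^ 4) := by
  have : IsProbabilityMeasure (P.map L) := Measure.isProbabilityMeasure_map hL.aemeasurable
  have h0 := zero_mem_interior_integrableExpSet_normLog hXpos hXint hXinv hXvar
  have hY := measurable_normLog (P := P) hX
  have hcdf : cdf (P.map L) q = 1 - α := by
    rw [hq]
    exact cdf_quantile (continuous_cdf hf (fun x => (hfpos x).le) hLf) (by linarith) (by linarith)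
  have hindY : IndepFun (normLog P X) L P :=
    hindep.comp (φ := fun x => (Real.log x - ∫ ω', Real.log (X ω') ∂P) /
      Real.sqrt (variance (fun ω' => Real.log (X ω')) P)) (ψ := id)
      ((Real.measurable_log.sub_const _).div_const _) measurable_id
  have hG := fun ε => hasExp_integral_cdf hY h0 (integral_normLog (memLp_log hXpos hXint hXinv))
    (integral_normLog_sq hX hXvar) rfl rfl hf hfpos hLf hfq φ ε
  have hprob : ∀ᶠ σ : ℝ in 𝓝 0, ∀ m : ℝ,
      P.real {ω | surplus (assetVol P X σ) L φ ω + m < 0} = 1 - ∫ ω, cdf (P.map L)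
        (φ + (m - φ) * mgf (normLog P X) P σ * Real.exp (-(σ * normLog P X ω))) ∂P := by
    filter_upwards [mem_interior_iff_mem_nhds.1 h0] with σ hσ m
    have hset : {ω | surplus (assetVol P X σ) L φ ω + m < 0} = {ω | (fun y => φ + (m - φ)
        * mgf (normLog P X) P σ * Real.exp (-(σ * y))) (normLog P X ω) < L ω} := by
      ext ω
      exact surplus_assetVol_add_neg_iff (mgf_pos hσ) ω
    rw [hset]
    exact measureReal_comp_lt_of_indepFun hY hL hindY (h := fun y => φ + (m - φ)
      * mgf (normLog P X) P σ * Real.exp (-(σ * y))) (by fun_prop)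
  rw [isLittleO_iff]
  intro ε hε
  -- Shifting the capital by `±ε σ⁴` moves the ruin probability by `∓f(q) ε σ⁴` to leading order; an
  -- error of half that size cannot reverse the comparison with `α`.
  have hc : 0 < f q * ε / 2 := by have := hfpos q; positivity
  have hup := (hG ε).def hc
  have hlo := (hG (-ε)).def hc
  filter_upwards [nhdsWithin_le_nhds hprob, nhdsWithin_le_nhds hup, nhdsWithin_le_nhds hlo,
    self_mem_nhdsWithin] with σ hp hu hl hσ
  have hσ4 : 0 < σ ^ 4 := pow_pos hσ 4
  have hgap : 0 < f q * ε * σ ^ 4 := by have := hfpos q; positivity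
  rw [Real.norm_eq_abs, Real.norm_of_nonneg hσ4.le, abs_le, hcdf] at hu hl
  have hmem := VaR_mem_Icc (P := P) (α := α) (Z := surplus (assetVol P X σ) L φ)
    (a := expansion4 f q (logMoment P X 3) (logMoment P X 4) σ φ + -ε * σ ^ 4)
    (b := expansion4 f q (logMoment P X 3) (logMoment P X 4) σ φ + ε * σ ^ 4)
    (by
      rw [hp]
      have := hl.2
      simp only [logMoment] at *
      linarith)
    (by
      rw [hp]
      have := hu.1
      simp only [logMoment] at *
      linarith)
  rw [Real.norm_eq_abs, Real.norm_of_nonneg hσ4.le, abs_le]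
  constructor <;> linarith [hmem.1, hmem.2]

end ValueAtRisk

end SurplusRisk
theorem mainTheorem4
    {Ω : Type*} [MeasurableSpace Ω] (P : Measure Ω) [IsProbabilityMeasure P]
    (X L : Ω → ℝ) (hX : Measurable X) (hL : Measurable L)
    (hXpos : ∀ᵐ ω ∂P, 0 < X ω) (hindep : IndepFun X L P)
    (hXint : Integrable X P) (hXinv : Integrable (fun ω => (X ω)⁻¹) P) (hLint : Integrable L P)
    (hXmean : ∫ ω, X ω ∂P = 1) (hLmean : ∫ ω, L ω ∂P = 0)
    (hXvar : variance (fun ω => Real.log (X ω)) P ≠ 0)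
    (f : ℝ → ℝ) (hf : Measurable f) (hfpos : ∀ x, 0 < f x) (hfbdd : ∃ C, ∀ x, f x ≤ C)
    (hLf : P.map L = volume.withDensity (fun x => ENNReal.ofReal (f x)))
    (α : ℝ) (hα0 : 0 < α) (hα1 : α < 1)
    (q : ℝ) (hq : q = SurplusRisk.quantile (P.map L) (1 - α))
    (hfq : ContDiffAt ℝ 3 f q)
    (μ₃ μ₄ : ℝ) (hμ₃ : μ₃ = SurplusRisk.logMoment P X 3) (hμ₄ : μ₄ = SurplusRisk.logMoment P X 4) :
    -- (a) fourth-order expansion of the value-at-risk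
    (∀ φ : ℝ,
      (fun σ : ℝ =>
        SurplusRisk.VaR P α (SurplusRisk.surplus (SurplusRisk.assetVol P X σ) L φ)
          - SurplusRisk.expansion4 f q μ₃ μ₄ σ φ)
        =o[𝓝[>] 0] (fun σ : ℝ => σ ^ 4)) ∧
    -- (b) local minimiser of the third-order expansion, genuinely cubic case
    (μ₃ * deriv (deriv f) q ≠ 0 →
      (∀ σ : ℝ, 0 < σ → ∀ φ : ℝ,
        (IsLocalMin (SurplusRisk.expansion3 f q μ₃ σ) φ ↔
          0 < SurplusRisk.discr (f q) (deriv f q) (deriv (deriv f) q) (1 / (σ * μ₃)) ∧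
          φ = q + (deriv (deriv f) q)⁻¹ *
            ((1 - 1 / (σ * μ₃)) * deriv f q
              - Real.sign μ₃ * Real.sqrt (SurplusRisk.discr (f q) (deriv f q)
                  (deriv (deriv f) q) (1 / (σ * μ₃)))))) ∧
      (deriv f q ≠ 0 → ∀ᶠ σ : ℝ in 𝓝[>] 0,
        0 < SurplusRisk.discr (f q) (deriv f q) (deriv (deriv f) q) (1 / (σ * μ₃)))) ∧
    -- (b) quadratic case
    (μ₃ * deriv (deriv f) q = 0 →
      ∀ σ : ℝ, 0 < σ → ∀ φ : ℝ,
        (IsMinOn (SurplusRisk.expansion3 f q μ₃ σ) Set.univ φ ↔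
          (1 - σ * μ₃) * deriv f q < 0 ∧ φ = q + f q / ((1 - σ * μ₃) * deriv f q))) ∧
    -- (b) quadratic case with vanishing skew
    (μ₃ = 0 → ∀ σ : ℝ, 0 < σ → ∀ φ : ℝ,
        (IsMinOn (SurplusRisk.expansion3 f q μ₃ σ) Set.univ φ ↔
          deriv f q < 0 ∧ φ = q + f q / deriv f q)) := by
  subst hμ₃ hμ₄
  have h0 := hfpos q
  refine ⟨fun φ => SurplusRisk.VaR_sub_expansion4_isLittleO hX hL hXpos hindep hXint hXinv hXvar
      hf hfpos hLf hα0 hα1 hq hfq φ, fun hμ => ⟨fun σ hσ φ =>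
      SurplusRisk.isLocalMin_expansion3_iff hfq h0 hσ hμ, fun h1 =>
      SurplusRisk.eventually_discr_pos (left_ne_zero_of_mul hμ) h1⟩, fun hμ σ hσ φ =>
      SurplusRisk.isMinOn_expansion3_iff hfq h0 hσ hμ, fun hμ σ hσ φ => ?_⟩
  rw [SurplusRisk.isMinOn_expansion3_iff hfq h0 hσ (by rw [hμ, zero_mul]), hμ, mul_zero, sub_zero,
    one_mul]
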